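/- Let $q$ be a prime power, $\mathbb{F}_q$ the field with $q$ elements, $\mathcal{K} = \mathbb{F}_q(T)$, and let $\widehat{\mathcal{K}}$ be the completion of $\mathcal{K}$ for the $T^{-1}$-adic topology, in which all infinite sums and products are taken. Let $\mathcal{A}_1$ be the set of monic polynomials in $\mathbb{F}_q[T]$. Let $\sqrt[q-1]{-T}$ be a $(q-1)$-st root of $-T$ in some extension field of $\widehat{\mathcal{K}}$, and let $$\overline{\pi} = \frac{T\,\sqrt[q-1]{-T}}{\prod_{A \in \mathbb{F}_q[T]\setminus\{0\}} \bigl(1-(TA)^{-1}\bigr)}.$$ Let $R$ be a commutative ring with a ring homomorphism $R \to \mathcal{K}$ (for instance $R = \mathbb{Z}$, $\mathbb{F}_q$ or $\mathcal{K}$), and let $\boldsymbol{f}$ be a homogeneous symmetric polynomial of degree $\ell \ge 0$ in infinitely many variables $X_0, X_1, X_2, \ldots$ with coefficients in $R$, that is, a possibly infinite formal $R$-linear combination of monomials of degree $\ell$ which is invariant under all permutations of the variables. Then the value $\boldsymbol{f}(1/A^{q-1})_{A \in \mathcal{A}_1}$, obtained by substituting the elements $1/A^{q-1}$, $A \in \mathcal{A}_1$,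 for the variables along any enumeration of $\mathcal{A}_1$ and summing all the resulting terms, converges unconditionally in $\widehat{\mathcal{K}}$, does not depend on the enumeration, and lies in $\overline{\pi}^{\,\ell(q-1)}\,\mathcal{K}$. -/

import Mathlib

open Polynomial

noncomputable section

namespace CarlitzSym

/-- A symmetric function over `R`: a formal power series in `X_0, X_1, X_2, …` invariant under
all permutations of the variables. Together with `MvPowerSeries.IsHomogeneous f ℓ` (all monomials
of `f` have degree `ℓ`) this is the usual notion of a homogeneous symmetric "polynomial" of
degree `ℓ` in infinitely many variables. -/
def IsSymmetricFunction {R : Type*} [CommRing R] (f : MvPowerSeries ℕ R) : Prop :=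
  ∀ σ : Equiv.Perm ℕ, MvPowerSeries.renameEquiv R σ f = f

/-- `s` is the value of `f` at the family `x`, where the coefficients of `f` are mapped to `S` by
`φ`: the sum of all terms of `f` at `x` converges (unconditionally) to `s`. -/
def HasValueAt {R S : Type*} [CommRing R] [CommRing S] [TopologicalSpace S]
    (φ : R →+* S) (f : MvPowerSeries ℕ R) (x : ℕ → S) (s : S) : Prop :=
  HasSum (fun d : ℕ →₀ ℕ => φ (MvPowerSeries.coeff d f) * d.prod fun i k => x i ^ k) s

variable (F : Type*) [Field F] [DecidableEq (RatFunc F)]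

/-- The completion of `F(T)` at the place at infinity, i.e. for the `T⁻¹`-adic topology. -/
abbrev KHat : Type _ := RatFunc.CompletionAtInfty F

/-- The inclusion of `F[T]` in the completion. -/
def polyToKHat : F[X] →+* KHat F :=
  (algebraMap (RatFunc F) (KHat F)).comp (algebraMap F[X] (RatFunc F))

/-- The infinite product of `1 - 1 / (T A)` over the nonzero polynomials `A`. -/
def periodProduct : KHat F :=
  ∏' A : {A : F[X] // A ≠ 0}, (1 - (polyToKHat F (X * A.1))⁻¹)


/-- The Carlitz period `π̄ = T λ / ∏_{A ≠ 0} (1 - 1 / (T A))`, in an extension `L` of the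
completion, for a `(q - 1)`-st root `λ` of `-T` in `L`. -/
def carlitzPeriod (L : Type*) [Field L] [Algebra (KHat F) L] (lam : L) : L :=
  algebraMap (KHat F) L (polyToKHat F X) * lam / algebraMap (KHat F) L (periodProduct F)

/-! The objects above are well defined: the product converges to a nonzero element, and the
monic polynomials can be enumerated. -/

theorem v_polyToKHat {A : F[X]} (hA : A ≠ 0) :
    Valued.v (polyToKHat F A) = WithZero.exp (A.natDegree : ℤ) := by
  let _ := RatFunc.inftyValued F
  exact (Valued.valuedCompletion_apply (K := RatFunc F) (algebraMap F[X] (RatFunc F) A)).trans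
    (RatFunc.inftyValuation.polynomial F hA)

theorem multipliable_periodProduct [Finite F] :
    Multipliable (fun A : {A : F[X] // A ≠ 0} => 1 - (polyToKHat F (X * A.1))⁻¹) := by
  have hc : CompleteSpace (KHat F) := inferInstanceAs (CompleteSpace
    (@UniformSpace.Completion (RatFunc F) (RatFunc.inftyValued F).toUniformSpace))
  have hn : NonarchimedeanAddGroup (KHat F) := by
    have h : @NonarchimedeanRing (KHat F) _
        (Valued.v (R := KHat F)).subgroups_basis.topology :=
      (Valued.v (R := KHat F)).subgroups_basis.nonarchimedean
    have e : (inferInstance : TopologicalSpace (KHat F)) =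
        (Valued.v (R := KHat F)).subgroups_basis.topology :=
      congrArg (·.toTopologicalSpace) (Valued.toUniformSpace_eq (KHat F) _)
    rw [← e] at h
    exact NonarchimedeanRing.to_nonarchimedeanAddGroup _
  simp_rw [sub_eq_add_neg]
  apply multipliable_one_add_of_summable_prod
  apply NonarchimedeanAddGroup.summable_of_tendsto_cofinite_zero
  rw [(Valued.hasBasis_nhds_zero (KHat F) _).tendsto_right_iff]
  intro γ _
  have hγ : MonoidWithZeroHom.ValueGroup₀.embedding γ.1 ≠ 0 := by simp
  have key : ∀ A : {A : F[X] // A ≠ 0}, Valued.v (-(polyToKHat F (X * A.1))⁻¹) =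
      WithZero.exp (-(A.1.natDegree + 1 : ℤ)) := fun A => by
    rw [Valuation.map_neg, map_inv₀, v_polyToKHat F (mul_ne_zero X_ne_zero A.2),
      natDegree_X_mul A.2, ← WithZero.exp_neg]
    push_cast
    rfl
  obtain ⟨k, hk⟩ : ∃ k : ℤ, WithZero.exp k = MonoidWithZeroHom.ValueGroup₀.embedding γ.1 :=
    ⟨_, WithZero.exp_log hγ⟩
  have hfin : {A : {A : F[X] // A ≠ 0} | A.1.natDegree < (-k).toNat}.Finite := by
    have : Finite (degreeLT F (-k).toNat) := Finite.of_equiv _ (degreeLTEquiv F _).toEquiv.symm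
    refine Set.Finite.of_finite_image (f := Subtype.val) ?_ Subtype.val_injective.injOn
    refine (Set.toFinite (degreeLT F (-k).toNat : Set F[X])).subset ?_
    rintro _ ⟨A, hA, rfl⟩
    exact mem_degreeLT.2 ((natDegree_lt_iff_degree_lt A.2).1 hA)
  rw [Filter.eventually_cofinite]
  refine (hfin.toFinset.powerset.finite_toSet).subset fun s hs => ?_
  simp only [Finset.coe_powerset, Set.mem_preimage, Set.mem_powerset_iff, Set.Finite.coe_toFinset]
  intro A hA
  classical
  by_contra hdeg
  refine hs ?_
  have hdeg' : -k ≤ (A.1.natDegree : ℤ) := by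
    simp only [Set.mem_ofPred_eq, not_lt] at hdeg
    omega
  change (Valued.v (R := KHat F)).restrict _ < _
  rw [Valuation.restrict_lt_iff_lt_embedding, ← hk, map_prod, ← Finset.mul_prod_erase s _ hA, key]
  refine lt_of_le_of_lt (mul_le_of_le_one_right' (Finset.prod_le_one' fun B _ => ?_)) ?_
  · rw [key, ← WithZero.exp_zero, WithZero.exp_le_exp]
    omega
  · rw [WithZero.exp_lt_exp]
    omega

theorem exists_enum (F : Type*) [Field F] [Finite F] : Nonempty (ℕ ≃ {A : F[X] // A.Monic}) := by
  have : Infinite {A : F[X] // A.Monic} :=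
    Infinite.of_injective (fun n : ℕ => (⟨X ^ n, monic_X_pow n⟩ : {A : F[X] // A.Monic}))
      fun a b h => by simpa using congrArg (fun x => natDegree x.1) h
  have : Countable F[X] := by
    rw [← Cardinal.mk_le_aleph0_iff]
    exact Polynomial.cardinalMk_le_max.trans (by simp)
  exact nonempty_equiv_of_countable

theorem periodProduct_ne_zero [Finite F] : periodProduct F ≠ 0 := by
  have h := (multipliable_periodProduct F).hasProd
  have hv : ∀ A : {A : F[X] // A ≠ 0}, Valued.v (1 - (polyToKHat F (X * A.1))⁻¹) = 1 := fun A => by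
    rw [Valuation.map_one_sub_of_lt]
    rw [map_inv₀, v_polyToKHat F (mul_ne_zero X_ne_zero A.2), natDegree_X_mul A.2, ← WithZero.exp_neg,
      ← WithZero.exp_zero, WithZero.exp_lt_exp]
    omega
  intro h0
  unfold periodProduct at h0
  rw [h0] at h
  have := h.eventually ((Valued.hasBasis_nhds_zero (KHat F) _).mem_of_mem (i := 1) trivial)
  obtain ⟨s, hs⟩ := this.exists
  change Valued.v.restrict _ < _ at hs
  rw [Valuation.restrict_lt_iff_lt_embedding, map_prod, Finset.prod_congr rfl fun A _ => hv A] at hs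
  simp at hs

end CarlitzSym

end

noncomputable section
namespace CarlitzSym

/-! Write `q` for the cardinality of `F`, `T` for the variable and `e_d(X) = ∏ (X - A)` over all `A`
of degree less than `d` (`carlitzPoly`). Grouping the `A ≠ 0` by their monic multiples gives `e_d =
X ∏ (X^(q-1) - A^(q-1))` over monic `A`. Hence the coefficients of `e_d`, divided by that of `X`,
are up to sign the elementary symmetric functions of the `1/A^(q-1)`.

The polynomial `e_d` is `q`-linear, so only the elementary functions of degree `k` with `k(q-1)+1 =
q^i` survive. Splitting off either the leading or the constant coefficient of `A` gives two
recursions for `e_(d+1)` in terms of `e_d`. Eliminating between them (`carlitzCoeff_succ`) shows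
that the normalized coefficients `a_(d,i)` of `X^(q^i)` satisfy `(T^(q^(i+1)) - T) a_(d,i+1) = p_d
a_(d,i)^q (1 - T^(q^(i+1) - q^(d+1)))`, where `p_d` tends to `π̄^(q-1)`. In the limit these are the
coefficients of a rescaled Carlitz exponential. By induction on `i`, the `k`-th elementary symmetric
function has a limit in `π̄^(k(q-1)) F(T)`.

A symmetric function of degree `ℓ` is a polynomial over `R`, isobaric of weight `ℓ`, in the
elementary ones (`exists_truncOn_eq_aeval`), so the powers of `π̄` combine to `π̄^(ℓ(q-1))`.
Convergence is nonarchimedean (`summable_value`): `f` has finitely many distinct coefficients and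
`1/A^(q-1)` tends to zero. Symmetry makes the value independent of the enumeration. -/

theorem map_C_eq {F K : Type*} [Field F] [Field K] [Algebra F K] (ι : F[X] →ₐ[F] K) (c : F) :
    ι (C c) = algebraMap F K c := ι.commutes c

/-! ### Polynomials vanishing on `deg A < d`: `q`-linearity and the two recursions. -/

section Carlitz

open Finset

variable (F : Type*) [Field F] [Fintype F]

/-- The finite set of polynomials of degree less than `d`. -/
def polysLT (d : ℕ) : Finset F[X] :=
  have : Finite (degreeLT F d) := Finite.of_equiv _ (degreeLTEquiv F d).toEquiv.symm
  (Set.toFinite (degreeLT F d : Set F[X])).toFinset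

variable {F}

theorem mem_polysLT {d : ℕ} {A : F[X]} : A ∈ polysLT F d ↔ ∀ n, d ≤ n → A.coeff n = 0 := by
  simp only [polysLT, Set.Finite.mem_toFinset, SetLike.mem_coe, mem_degreeLT,
    degree_lt_iff_coeff_zero]

theorem polysLT_zero : polysLT F 0 = {0} := by
  ext A
  simp [mem_polysLT, Polynomial.ext_iff]

theorem zero_mem_polysLT (d : ℕ) : (0 : F[X]) ∈ polysLT F d := by simp [mem_polysLT]

theorem C_mul_mem_polysLT {d : ℕ} {A : F[X]} (c : F) (hA : A ∈ polysLT F d) :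
    C c * A ∈ polysLT F d := by
  rw [mem_polysLT] at *
  intro n hn
  simp [hA n hn]

theorem prod_polysLT_succ_low {M : Type*} [CommMonoid M] (g : F[X] → M) (d : ℕ) :
    ∏ A ∈ polysLT F (d + 1), g A = ∏ c : F, ∏ B ∈ polysLT F d, g (C c + X * B) := by
  rw [← prod_product']
  refine prod_nbij' (fun A => (A.coeff 0, divX A)) (fun p => C p.1 + X * p.2) ?_ ?_ ?_ ?_ ?_
  · intro A hA
    simp only [mem_product, mem_univ, true_and, mem_polysLT, coeff_divX] at *
    exact fun n hn => hA _ (by omega)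
  · rintro ⟨c, B⟩ hB
    simp only [mem_product, mem_univ, true_and, mem_polysLT] at *
    intro n hn
    obtain ⟨m, rfl⟩ : ∃ m, n = m + 1 := ⟨n - 1, by omega⟩
    simp [coeff_C_succ, hB m (by omega)]
  · intro A _
    simp [add_comm, X_mul_divX_add]
  · rintro ⟨c, B⟩ _
    ext1
    · simp
    · ext n
      simp [coeff_divX, coeff_C_succ]
  · intro A _
    congr 1
    simp [add_comm, X_mul_divX_add]

theorem prod_polysLT_succ_high {M : Type*} [CommMonoid M] (g : F[X] → M) (d : ℕ) :
    ∏ A ∈ polysLT F (d + 1), g A = ∏ c : F, ∏ B ∈ polysLT F d, g (C c * X ^ d + B) := by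
  rw [← prod_product']
  refine prod_nbij' (fun A => (A.coeff d, A - C (A.coeff d) * X ^ d))
    (fun p => C p.1 * X ^ d + p.2) ?_ ?_ ?_ ?_ ?_
  · intro A hA
    simp only [mem_product, mem_univ, true_and, mem_polysLT] at *
    intro n hn
    rcases hn.eq_or_lt with rfl | hn
    · simp
    · simp [coeff_X_pow, hn.ne', hA n hn]
  · rintro ⟨c, B⟩ hB
    simp only [mem_product, mem_univ, true_and, mem_polysLT] at *
    intro n hn
    simp [coeff_X_pow, (show n ≠ d by omega), hB n (by omega)]
  · intro A _
    simp
  · rintro ⟨c, B⟩ hB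
    simp only [mem_product, mem_univ, true_and, mem_polysLT] at hB
    simp [hB d le_rfl]
  · intro A _
    simp

theorem card_polysLT (d : ℕ) : #(polysLT F d) = Fintype.card F ^ d := by
  induction d with
  | zero => simp [polysLT_zero]
  | succ d ih =>
    have h := prod_polysLT_succ_low (F := F) (fun _ => Multiplicative.ofAdd 1) d
    simp only [prod_const, ih, card_univ, ← ofAdd_nsmul, Multiplicative.ofAdd.injective.eq_iff,
      smul_eq_mul, mul_one] at h
    rw [h, pow_succ']

local notation "q" => Fintype.card F

theorem prod_X_sub_C_algebraMap {K : Type*} [Field K] [Algebra F K] :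
    ∏ c : F, (X - C (algebraMap F K c)) = X ^ q - X := by
  have h : ∏ c : F, (X - C c) = X ^ q - X := by
    have hm : (X ^ q - X : F[X]).Monic :=
      monic_X_pow_sub (by simpa [degree_X] using mod_cast Fintype.one_lt_card)
    have hs := FiniteField.roots_X_pow_card_sub_X F
    rw [← Finset.prod_map_val, ← hs]
    refine prod_multiset_X_sub_C_of_monic_of_roots_card_eq hm ?_
    rw [hs, FiniteField.X_pow_card_sub_X_natDegree_eq F Fintype.one_lt_card]
    simp
  have := congrArg (Polynomial.map (algebraMap F K)) h
  simpa [Polynomial.map_prod] using this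

/-- This is `∏ (X - c) = X^q - X` homogenized: substitute `y/z` and multiply by `z^q`. The target
`S` is a `K`-algebra so that `y` may itself be a polynomial. -/
theorem prod_sub_smul {K S : Type*} [Field K] [Algebra F K] [CommRing S] [Algebra K S]
    (y : S) (z : K) :
    ∏ c : F, (y - algebraMap K S (algebraMap F K c * z)) = y ^ q - algebraMap K S (z ^ (q - 1)) * y := by
  have hq : 1 < q := Fintype.one_lt_card
  rcases eq_or_ne z 0 with rfl | hz
  · simp [zero_pow (show q - 1 ≠ 0 by omega)]
  have h := congrArg (aeval (algebraMap K S z⁻¹ * y)) (prod_X_sub_C_algebraMap (F := F) (K := K))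
  simp only [map_prod, map_sub, aeval_X, aeval_C, map_pow] at h
  have h2 := congrArg (algebraMap K S z ^ q * ·) h
  have hinv : algebraMap K S z * algebraMap K S z⁻¹ = 1 := by rw [← map_mul]; simp [hz]
  calc _ = ∏ c : F, (algebraMap K S z * (algebraMap K S z⁻¹ * y - algebraMap K S (algebraMap F K c))) := by
        refine prod_congr rfl fun c _ => ?_
        rw [mul_sub, ← mul_assoc, hinv, map_mul]; ring
    _ = _ := by
        rw [prod_mul_distrib, h, prod_const, card_univ, mul_sub, ← mul_pow, ← mul_assoc, hinv, one_mul]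
        congr 1
        rw [← mul_assoc]
        congr 1
        obtain ⟨m, hm⟩ : ∃ m, q = m + 1 := ⟨q - 1, by omega⟩
        rw [hm, pow_succ, mul_assoc, hinv]; simp

variable {K : Type*} [Field K] [Algebra F K]

variable (F K) in
/-- The `K`-space of `q`-linear polynomials. -/
def qLinear : Submodule K K[X] := Submodule.span K (Set.range fun i : ℕ => X ^ q ^ i)

theorem pow_card_mem_qLinear {g : K[X]} (hg : g ∈ qLinear F K) : g ^ q ∈ qLinear F K := by
  have hfrob : ∀ a : K[X], FiniteField.frobeniusAlgHom F K[X] a = a ^ q := fun a => rfl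
  induction hg using Submodule.span_induction with
  | mem x hx =>
    obtain ⟨i, rfl⟩ := hx
    exact Submodule.subset_span ⟨i + 1, by simp [pow_succ, pow_mul]⟩
  | zero => rw [zero_pow Fintype.card_ne_zero]; exact zero_mem _
  | add x y _ _ hx hy => rw [← hfrob, map_add]; exact add_mem hx hy
  | smul a x _ hx => rw [_root_.smul_pow]; exact Submodule.smul_mem _ _ hx

theorem comp_X_sub_C_of_mem_qLinear {g : K[X]} (hg : g ∈ qLinear F K) (a : K) :
    g.comp (X - C a) = g - C (g.eval a) := by
  have hfrob : ∀ i : ℕ, ∀ a : K[X], (FiniteField.frobeniusAlgHom F K[X] ^ i) a = a ^ q ^ i := by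
    intro i a
    induction i with
    | zero => simp
    | succ i ih => rw [pow_succ', AlgHom.mul_apply, ih, pow_succ, pow_mul]; rfl
  induction hg using Submodule.span_induction with
  | mem x hx =>
    obtain ⟨i, rfl⟩ := hx
    simp only [pow_comp, X_comp]
    rw [← hfrob, map_sub, hfrob, hfrob]
    simp
  | zero => simp
  | add x y _ _ hx hy => simp only [add_comp, hx, hy, eval_add, C_add]; ring
  | smul b x _ hx => simp [hx, smul_eq_C_mul, mul_sub]

theorem eval_algebraMap_mul_of_mem_qLinear {g : K[X]} (hg : g ∈ qLinear F K) (c : F) (a : K) :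
    g.eval (algebraMap F K c * a) = algebraMap F K c * g.eval a := by
  induction hg using Submodule.span_induction with
  | mem x hx =>
    obtain ⟨i, rfl⟩ := hx
    simp only [eval_pow, eval_X, mul_pow]
    rw [← map_pow, FiniteField.pow_card_pow]
  | zero => simp
  | add x y _ _ hx hy => simp only [eval_add, hx, hy]; ring
  | smul b x _ hx => simp only [eval_smul, hx, smul_eq_mul]; ring

/-- By additivity and `F`-linearity each factor is `g - c g(a)`, so `prod_sub_smul` applies with `y
= g` and `z = g(a)`. Both recursions are instances of this identity. -/
theorem prod_comp_of_mem_qLinear {g : K[X]} (hg : g ∈ qLinear F K) (a : K) :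
    ∏ c : F, g.comp (X - C (algebraMap F K c * a)) = g ^ q - C (g.eval a ^ (q - 1)) * g := by
  rw [← algebraMap_eq, ← prod_sub_smul]
  refine prod_congr rfl fun c _ => ?_
  rw [algebraMap_eq, comp_X_sub_C_of_mem_qLinear hg, eval_algebraMap_mul_of_mem_qLinear hg]

omit [Field F] [Algebra F K] in
theorem coeff_eq_zero_of_mem_qLinear {g : K[X]} (hg : g ∈ qLinear F K) {n : ℕ}
    (hn : ∀ i, n ≠ q ^ i) : g.coeff n = 0 := by
  induction hg using Submodule.span_induction with
  | mem x hx => obtain ⟨i, rfl⟩ := hx; simp [coeff_X_pow, hn]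
  | zero => simp
  | add x y _ _ hx hy => simp [hx, hy]
  | smul b x _ hx => simp [hx]

theorem coeff_pow_card_succ (g : K[X]) (i : ℕ) :
    (g ^ q).coeff (q ^ (i + 1)) = g.coeff (q ^ i) ^ q := by
  have hK : ∀ a : K, FiniteField.frobeniusAlgHom F K a = a ^ q := fun a => rfl
  have hfrob : ∀ a : K[X], FiniteField.frobeniusAlgHom F K[X] a = a ^ q := fun a => rfl
  induction g using Polynomial.induction_on' with
  | add x y hx hy =>
    rw [← hfrob, map_add, coeff_add, hfrob, hfrob, hx, hy, coeff_add, ← hK, ← hK, ← map_add, hK]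
  | monomial n a =>
    rw [monomial_pow, coeff_monomial, coeff_monomial]
    have : n * q = q ^ (i + 1) ↔ n = q ^ i := by
      rw [pow_succ]; exact Nat.mul_left_inj Fintype.card_ne_zero
    by_cases h : n = q ^ i
    · simp [h, pow_succ]
    · rw [if_neg (this.not.2 h), if_neg h, zero_pow Fintype.card_ne_zero]

theorem coeff_pow_card_one (g : K[X]) : (g ^ q).coeff 1 = 0 := by
  have hq : 1 < q := Fintype.one_lt_card
  have hfrob : ∀ a : K[X], FiniteField.frobeniusAlgHom F K[X] a = a ^ q := fun a => rfl
  induction g using Polynomial.induction_on' with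
  | add x y hx hy => rw [← hfrob, map_add, coeff_add, hfrob, hfrob, hx, hy, add_zero]
  | monomial n a =>
    rw [monomial_pow, coeff_monomial, if_neg]
    intro h
    exact hq.ne' (Nat.eq_one_of_mul_eq_one_left h)

variable (ι : F[X] →ₐ[F] K)

/-- The polynomial whose roots are the polynomials of degree less than `d`. -/
def carlitzPoly (d : ℕ) : K[X] := ∏ A ∈ polysLT F d, (X - C (ι A))

/-- Splits `A = c T^d + B` by its top coefficient. Membership in `qLinear` is a hypothesis because
the recursion is what carries that membership from `d` to `d + 1`. -/
theorem carlitzPoly_succ_of_mem {d : ℕ} (h : carlitzPoly ι d ∈ qLinear F K) :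
    carlitzPoly ι (d + 1) = carlitzPoly ι d ^ q
      - C ((carlitzPoly ι d).eval (ι X ^ d) ^ (q - 1)) * carlitzPoly ι d := by
  rw [← prod_comp_of_mem_qLinear h, carlitzPoly, prod_polysLT_succ_high]
  refine prod_congr rfl fun c _ => ?_
  rw [carlitzPoly, Polynomial.prod_comp]
  refine prod_congr rfl fun B _ => ?_
  simp only [map_add, map_mul, map_pow, map_C_eq, sub_comp, X_comp, C_comp]
  ring

theorem carlitzPoly_mem_qLinear (d : ℕ) : carlitzPoly ι d ∈ qLinear F K := by
  induction d with
  | zero =>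
    simp only [carlitzPoly, polysLT_zero, prod_singleton, map_zero, sub_zero]
    exact Submodule.subset_span ⟨0, by simp⟩
  | succ d ih =>
    rw [carlitzPoly_succ_of_mem ι ih, ← smul_eq_C_mul]
    exact sub_mem (pow_card_mem_qLinear ih) (Submodule.smul_mem _ _ ih)

theorem carlitzPoly_succ (d : ℕ) :
    carlitzPoly ι (d + 1) = carlitzPoly ι d ^ q
      - C ((carlitzPoly ι d).eval (ι X ^ d) ^ (q - 1)) * carlitzPoly ι d :=
  carlitzPoly_succ_of_mem ι (carlitzPoly_mem_qLinear ι d)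

/-- Splits `A = c + T B` by its constant coefficient: `T X - A = T (X - c/T - B)`, and the `q^(d+1)`
factors `T` come out in front. -/
theorem carlitzPoly_succ_comp (hT : ι X ≠ 0) (d : ℕ) :
    (carlitzPoly ι (d + 1)).comp (C (ι X) * X) = C (ι X ^ q ^ (d + 1)) * (carlitzPoly ι d ^ q
      - C ((carlitzPoly ι d).eval (ι X)⁻¹ ^ (q - 1)) * carlitzPoly ι d) := by
  rw [← prod_comp_of_mem_qLinear (carlitzPoly_mem_qLinear ι d), carlitzPoly,
    prod_polysLT_succ_low, Polynomial.prod_comp, pow_succ, pow_mul, C_pow, ← card_univ, ← prod_const,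
    ← prod_mul_distrib]
  refine prod_congr rfl fun c _ => ?_
  rw [carlitzPoly, Polynomial.prod_comp, Polynomial.prod_comp, card_univ, ← card_polysLT (F := F) d, C_pow, ← prod_const,
    ← prod_mul_distrib]
  refine prod_congr rfl fun B _ => ?_
  have : C (ι X) * C (ι X)⁻¹ = (1 : K[X]) := by rw [← C_mul, mul_inv_cancel₀ hT, C_1]
  simp only [map_add, map_mul, map_C_eq, sub_comp, X_comp, C_comp, add_comp, mul_comp]
  linear_combination (C (algebraMap F K c)) * this

end Carlitz

/-! ### Coefficients as elementary symmetric functions, and their recursion in the degree. -/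

section Coefficients
open Finset
variable {F : Type*} [Field F] [Fintype F] {K : Type*} [Field K] [Algebra F K] (ι : F[X] →ₐ[F] K)
local notation "q" => Fintype.card F

/-- The monic polynomials of degree less than `d`. -/
def monicsLT (F : Type*) [Field F] [Fintype F] (d : ℕ) : Finset F[X] :=
  open Classical in {A ∈ polysLT F d | A.Monic}

theorem mem_monicsLT {d : ℕ} {A : F[X]} : A ∈ monicsLT F d ↔ A ∈ polysLT F d ∧ A.Monic := by
  simp [monicsLT]

open Classical in
theorem prod_erase_zero_polysLT {M : Type*} [CommMonoid M] (g : F[X] → M) (d : ℕ) :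
    ∏ A ∈ (polysLT F d).erase 0, g A =
      ∏ A ∈ monicsLT F d, ∏ c ∈ univ.erase (0 : F), g (C c * A) := by
  rw [← prod_product']
  refine prod_nbij' (fun A => (C A.leadingCoeff⁻¹ * A, A.leadingCoeff)) (fun p => C p.2 * p.1)
    ?_ ?_ ?_ ?_ ?_
  · intro A hA
    simp only [mem_erase] at hA
    simp only [mem_product, mem_monicsLT, mem_erase, mem_univ, and_true, ne_eq,
      leadingCoeff_eq_zero, hA.1, not_false_eq_true]
    refine ⟨C_mul_mem_polysLT _ hA.2, ?_⟩
    simp [Monic, hA.1]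
  · rintro ⟨A, c⟩ h
    simp only [mem_product, mem_monicsLT, mem_erase, mem_univ, and_true] at h
    simp only [mem_erase, ne_eq, mul_eq_zero, C_eq_zero, h.2, h.1.2.ne_zero, or_self,
      not_false_eq_true, true_and]
    exact C_mul_mem_polysLT _ h.1.1
  · intro A hA
    simp only [mem_erase] at hA
    simp [← mul_assoc, ← C_mul, hA.1]
  · rintro ⟨A, c⟩ h
    simp only [mem_product, mem_monicsLT, mem_erase, mem_univ, and_true] at h
    simp [← mul_assoc, ← C_mul, h.1.2.leadingCoeff, h.2]
  · intro A hA
    simp only [mem_erase] at hA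
    simp [← mul_assoc, ← C_mul, hA.1]

open Classical in
theorem carlitzPoly_eq_X_mul (d : ℕ) :
    carlitzPoly ι d = X * ∏ A ∈ (polysLT F d).erase 0, (X - C (ι A)) := by
  rw [carlitzPoly, ← mul_prod_erase _ _ (zero_mem_polysLT d)]
  simp

open Classical in
theorem prod_erase_zero_X_sub_C (a : K) :
    ∏ c ∈ univ.erase (0 : F), (X - C (algebraMap F K c * a)) = X ^ (q - 1) - C (a ^ (q - 1)) := by
  have h := prod_sub_smul (F := F) (S := K[X]) X a
  rw [← mul_prod_erase _ _ (mem_univ 0)] at h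
  refine mul_left_cancel₀ (X_ne_zero (R := K)) ?_
  simp only [map_zero, zero_mul, sub_zero, algebraMap_eq] at h
  rw [h, mul_sub, ← pow_succ', Nat.sub_add_cancel Fintype.card_pos, mul_comm X]

theorem carlitzPoly_eq_X_mul_monics (d : ℕ) :
    carlitzPoly ι d = X * ∏ A ∈ monicsLT F d, (X ^ (q - 1) - C (ι A ^ (q - 1))) := by
  classical
  rw [carlitzPoly_eq_X_mul, prod_erase_zero_polysLT]
  congr 1
  refine prod_congr rfl fun A _ => ?_
  rw [← prod_erase_zero_X_sub_C]
  simp only [map_mul ι, map_C_eq]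

open Classical in
theorem coeff_one_carlitzPoly (d : ℕ) :
    (carlitzPoly ι d).coeff 1 = ∏ A ∈ (polysLT F d).erase 0, -ι A := by
  rw [carlitzPoly_eq_X_mul, coeff_X_mul, coeff_zero_eq_eval_zero, eval_prod]
  simp

theorem coeff_one_carlitzPoly_ne_zero (hι : Function.Injective ι) (d : ℕ) :
    (carlitzPoly ι d).coeff 1 ≠ 0 := by
  classical
  rw [coeff_one_carlitzPoly, prod_ne_zero_iff]
  intro A hA
  rw [neg_ne_zero, map_ne_zero_iff _ hι]
  exact ne_of_mem_erase hA

theorem coeff_prod_one_sub_C_mul_X {α : Type*} (S : Finset α) (x : α → K) (k : ℕ) :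
    (∏ i ∈ S, (1 - C (x i) * X)).coeff k = (-1) ^ k * ∑ t ∈ powersetCard k S, ∏ i ∈ t, x i := by
  classical
  have h : ∀ t ∈ S.powerset, (∏ i ∈ t, (-(C (x i) * X))).coeff k =
      if #t = k then (-1) ^ k * ∏ i ∈ t, x i else 0 := by
    intro t _
    have : ∏ i ∈ t, (-(C (x i) * X)) = C (∏ i ∈ t, -x i) * X ^ #t := by
      rw [map_prod, ← prod_const, ← prod_mul_distrib]
      simp
    rw [this, coeff_C_mul_X_pow, prod_neg]
    by_cases h : #t = k
    · simp [h]
    · simp [h, Ne.symm h]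
  simp_rw [sub_eq_add_neg]
  rw [prod_one_add, finsetSum_coeff, sum_congr rfl h, ← sum_filter, powersetCard_eq_filter, mul_sum]

/-- After the factor `X` is removed, what remains is a polynomial in `X^(q-1)`; dividing each factor
by its constant term turns it into `∏ (1 - Y / A^(q-1))` at `Y = X^(q-1)`. -/
theorem coeff_carlitzPoly_eq_esymm (hι : Function.Injective ι) (d k : ℕ) :
    (carlitzPoly ι d).coeff (k * (q - 1) + 1) = (carlitzPoly ι d).coeff 1 *
      ((-1) ^ k * ∑ t ∈ powersetCard k (monicsLT F d), ∏ A ∈ t, 1 / ι A ^ (q - 1)) := by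
  have hq : 0 < q - 1 := by have : 1 < q := Fintype.one_lt_card; omega
  have h : ∏ A ∈ monicsLT F d, (X ^ (q - 1) - C (ι A ^ (q - 1))) =
      C (∏ A ∈ monicsLT F d, -ι A ^ (q - 1)) *
        expand K (q - 1) (∏ A ∈ monicsLT F d, (1 - C (1 / ι A ^ (q - 1)) * X)) := by
    rw [map_prod, map_prod, ← prod_mul_distrib]
    refine prod_congr rfl fun A hA => ?_
    have hA' : ι A ^ (q - 1) ≠ 0 :=
      pow_ne_zero _ ((map_ne_zero_iff _ hι).2 (mem_monicsLT.1 hA).2.ne_zero)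
    rw [map_sub, map_one, map_mul, expand_C, expand_X, mul_sub, ← mul_assoc, ← C_mul, neg_mul,
      mul_one_div_cancel hA']
    simp only [map_neg, map_one]
    ring
  have h1 : (carlitzPoly ι d).coeff 1 = (carlitzPoly ι d).coeff (0 * (q - 1) + 1) := by simp
  have hc := coeff_expand_mul hq (∏ A ∈ monicsLT F d, (1 - C (1 / ι A ^ (q - 1)) * X))
  rw [h1, carlitzPoly_eq_X_mul_monics, coeff_X_mul, coeff_X_mul, h, coeff_C_mul, coeff_C_mul, hc,
    hc, coeff_prod_one_sub_C_mul_X, coeff_prod_one_sub_C_mul_X]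
  simp

/-- The coefficients of the polynomial with constant term one vanishing at the nonzero
polynomials of degree less than `d`. -/
def carlitzCoeff (d i : ℕ) : K :=
  (carlitzPoly ι d).coeff (q ^ i) / (carlitzPoly ι d).coeff 1

theorem carlitzCoeff_zero (hι : Function.Injective ι) (d : ℕ) : carlitzCoeff ι d 0 = 1 := by
  rw [carlitzCoeff, pow_zero, div_self (coeff_one_carlitzPoly_ne_zero ι hι d)]

theorem esymm_eq_carlitzCoeff (hι : Function.Injective ι) {k i : ℕ} (h : k * (q - 1) + 1 = q ^ i)
    (d : ℕ) : ∑ t ∈ powersetCard k (monicsLT F d), ∏ A ∈ t, 1 / ι A ^ (q - 1) =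
      (-1) ^ k * carlitzCoeff ι d i := by
  have h0 := coeff_one_carlitzPoly_ne_zero ι hι d
  rw [carlitzCoeff, ← h, coeff_carlitzPoly_eq_esymm ι hι, mul_div_cancel_left₀ _ h0, ← mul_assoc,
    ← mul_pow]
  simp

theorem esymm_eq_zero (hι : Function.Injective ι) {k : ℕ} (h : ∀ i, k * (q - 1) + 1 ≠ q ^ i)
    (d : ℕ) : ∑ t ∈ powersetCard k (monicsLT F d), ∏ A ∈ t, 1 / ι A ^ (q - 1) = 0 := by
  have h0 := coeff_one_carlitzPoly_ne_zero ι hι d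
  have := coeff_carlitzPoly_eq_esymm ι hι d k
  rw [coeff_eq_zero_of_mem_qLinear (carlitzPoly_mem_qLinear ι d) h] at this
  simpa [h0] using this.symm

open Classical in
/-- The finite approximations to `π̄ ^ (q - 1)`. -/
def periodApprox (d : ℕ) : K :=
  -ι X ^ q / (∏ A ∈ (polysLT F d).erase 0, (1 - (ι (X * A))⁻¹)) ^ (q - 1)

/-- This is where the period enters: the value of `e_d` at `1/T`, which occurs in
`carlitzPoly_succ_comp`, is a partial product of the period up to elementary factors. -/
theorem coeff_one_carlitzPoly_succ (hι : Function.Injective ι) (d : ℕ) :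
    ι X ^ q ^ (d + 1) * (carlitzPoly ι d).coeff 1 ^ q =
      periodApprox ι d * (carlitzPoly ι (d + 1)).coeff 1 := by
  classical
  have hT : ι X ≠ 0 := (map_ne_zero_iff _ hι).2 X_ne_zero
  have hq : 1 < q := Fintype.one_lt_card
  have hN := coeff_one_carlitzPoly_ne_zero ι hι d
  have hN' := coeff_one_carlitzPoly_ne_zero ι hι (d + 1)
  set P := ∏ A ∈ (polysLT F d).erase 0, (1 - (ι (X * A))⁻¹) with hP
  -- Each factor is `1/T - A = -A (1 - 1/(T A))`; the `-A` multiply to the coefficient of `X`.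
  have hε : (carlitzPoly ι d).eval (ι X)⁻¹ = (ι X)⁻¹ * ((carlitzPoly ι d).coeff 1 * P) := by
    rw [coeff_one_carlitzPoly, carlitzPoly_eq_X_mul, eval_mul, eval_X, eval_prod, hP,
      ← prod_mul_distrib]
    congr 1
    refine prod_congr rfl fun A hA => ?_
    have : ι A ≠ 0 := (map_ne_zero_iff _ hι).2 (ne_of_mem_erase hA)
    simp only [eval_sub, eval_X, eval_C, map_mul, mul_inv]
    field_simp
    ring
  have h := congrArg (coeff · 1) (carlitzPoly_succ_comp ι hT d)
  simp only [comp_C_mul_X_coeff, coeff_C_mul, coeff_sub, coeff_pow_card_one, hε, pow_one,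
    zero_sub] at h
  obtain ⟨m, hm⟩ : ∃ m, q = m + 1 := ⟨q - 1, by omega⟩
  -- If the partial product vanished, the recursion would force the coefficient of `X` in `e_(d+1)`
  -- to be zero.
  have hP0 : P ^ m ≠ 0 := by
    intro h0
    rw [hm, Nat.add_sub_cancel, mul_pow, mul_pow, h0] at h
    simp [hN', hT] at h
  rw [periodApprox, ← hP]
  rw [hm] at h ⊢
  simp only [Nat.add_sub_cancel] at h ⊢
  rw [div_mul_eq_mul_div, eq_div_iff hP0, mul_pow, mul_pow, inv_pow] at *
  field_simp at h
  linear_combination h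

/-- The two recursions, read in degrees `1` and `q^(i+1)`, give four linear relations. The values
`e_d(1/T)` and `e_d(T^d)` and the coefficient of `e_(d+1)` in degree `q^(i+1)` are eliminated,
leaving a relation at the single level `d`. -/
theorem carlitzCoeff_succ (hι : Function.Injective ι) (d i : ℕ) :
    (ι X ^ q ^ (i + 1) - ι X) * carlitzCoeff ι d (i + 1) = periodApprox ι d *
      carlitzCoeff ι d i ^ q * (1 - ι X ^ q ^ (i + 1) / ι X ^ q ^ (d + 1)) := by
  have hT : ι X ≠ 0 := (map_ne_zero_iff _ hι).2 X_ne_zero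
  have hN := coeff_one_carlitzPoly_ne_zero ι hι d
  have hN' := coeff_one_carlitzPoly_ne_zero ι hι (d + 1)
  have hrec := coeff_one_carlitzPoly_succ ι hι d
  have h1 := congrArg (coeff · (q ^ (i + 1))) (carlitzPoly_succ_comp ι hT d)
  have h2 := congrArg (coeff · (q ^ (i + 1))) (carlitzPoly_succ ι d)
  have h3 := congrArg (coeff · 1) (carlitzPoly_succ_comp ι hT d)
  have h4 := congrArg (coeff · 1) (carlitzPoly_succ ι d)
  simp only [comp_C_mul_X_coeff, coeff_C_mul, coeff_sub, coeff_pow_card_one, coeff_pow_card_succ,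
    pow_one, zero_sub] at h1 h2 h3 h4
  simp only [carlitzCoeff, div_pow]
  generalize (carlitzPoly ι d).coeff 1 = N at *
  generalize (carlitzPoly ι (d + 1)).coeff 1 = N' at *
  generalize periodApprox ι d = p at *
  generalize (carlitzPoly ι d).coeff (q ^ (i + 1)) = g at *
  generalize (carlitzPoly ι (d + 1)).coeff (q ^ (i + 1)) = g' at *
  generalize (carlitzPoly ι d).coeff (q ^ i) ^ q = b at *
  generalize eval (ι X)⁻¹ (carlitzPoly ι d) ^ (q - 1) = e at *
  generalize eval (ι X ^ d) (carlitzPoly ι d) ^ (q - 1) = δ at *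
  have hU : ι X ^ q ^ (d + 1) ≠ 0 := pow_ne_zero _ hT
  generalize ι X ^ q ^ (d + 1) = U at *
  generalize ι X ^ q ^ (i + 1) = W at *
  have hNq : N ^ q ≠ 0 := pow_ne_zero _ hN
  have hp : p = U * N ^ q / N' := by rw [hrec]; field_simp
  rw [hp]
  generalize N ^ q = M at *
  have key : (W - ι X) * g * N' = N * b * (U - W) := by
    linear_combination W * g * h4 - g * h3 + N * h1 - N * W * h2
  field_simp
  linear_combination key

end Coefficients

/-! ### The fundamental theorem on symmetric functions, uniformly in the set of variables. -/

section Symmetric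
open Finset
variable {R : Type*} [CommRing R]

variable (R) in
/-- The elementary symmetric polynomial of degree `k` in the variables indexed by `S`. -/
def esymmOn (S : Finset ℕ) (k : ℕ) : MvPolynomial ℕ R :=
  ∑ t ∈ powersetCard k S, ∏ i ∈ t, MvPolynomial.X i

/-- The part of degree `ℓ` of the power series `f` which only involves variables indexed
by `S`. -/
def truncOn (f : MvPowerSeries ℕ R) (ℓ : ℕ) (S : Finset ℕ) : MvPolynomial ℕ R :=
  ∑ d ∈ finsuppAntidiag S ℓ, MvPolynomial.monomial d (MvPowerSeries.coeff d f)

theorem coeff_truncOn (f : MvPowerSeries ℕ R) (ℓ : ℕ) (S : Finset ℕ) (d : ℕ →₀ ℕ) :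
    (truncOn f ℓ S).coeff d =
      if d.degree = ℓ ∧ d.support ⊆ S then MvPowerSeries.coeff d f else 0 := by
  have h : d ∈ finsuppAntidiag S ℓ ↔ d.degree = ℓ ∧ d.support ⊆ S := by
    rw [mem_finsuppAntidiag']; rfl
  simp only [truncOn, MvPolynomial.coeff_sum, MvPolynomial.coeff_monomial, sum_ite_eq', h]

variable (R) in
/-- The substitution of `0` for the variables outside of `U`. -/
def restrictVars (U : Finset ℕ) : MvPolynomial ℕ R →ₐ[R] MvPolynomial ℕ R :=
  MvPolynomial.aeval fun i => if i ∈ U then MvPolynomial.X i else 0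

theorem prod_ite_X_zero {M : Type*} [CommMonoidWithZero M] (x : ℕ → M) (U t : Finset ℕ)
    (e : ℕ → ℕ) (he : ∀ i ∈ t, e i ≠ 0) :
    ∏ i ∈ t, (if i ∈ U then x i else 0) ^ e i = if t ⊆ U then ∏ i ∈ t, x i ^ e i else 0 := by
  split_ifs with h
  · exact prod_congr rfl fun i hi => by rw [if_pos (h hi)]
  · obtain ⟨i, hi, hiU⟩ := not_subset.1 h
    exact prod_eq_zero hi (by rw [if_neg hiU, zero_pow (he i hi)])

theorem coeff_restrictVars (U : Finset ℕ) (g : MvPolynomial ℕ R) (d : ℕ →₀ ℕ) :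
    (restrictVars R U g).coeff d = if d.support ⊆ U then g.coeff d else 0 := by
  induction g using MvPolynomial.induction_on' with
  | add p r hp hr =>
    rw [map_add, MvPolynomial.coeff_add, hp, hr, MvPolynomial.coeff_add]
    split_ifs <;> simp
  | monomial e r =>
    rw [restrictVars, MvPolynomial.aeval_monomial, Finsupp.prod,
      prod_ite_X_zero _ _ _ _ fun i hi => Finsupp.mem_support_iff.1 hi, MvPolynomial.coeff_monomial]
    by_cases hed : e = d
    · subst hed
      by_cases h : e.support ⊆ U
      · have := MvPolynomial.monomial_eq (s := e) (a := r)
        rw [Finsupp.prod] at this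
        rw [if_pos h, if_pos h, MvPolynomial.algebraMap_eq, ← this]
        simp
      · simp [h]
    · rw [if_neg hed, ite_self]
      by_cases h : e.support ⊆ U
      · have := MvPolynomial.monomial_eq (s := e) (a := r)
        rw [Finsupp.prod] at this
        rw [if_pos h, MvPolynomial.algebraMap_eq, ← this, MvPolynomial.coeff_monomial, if_neg hed]
      · simp [h]

theorem restrictVars_truncOn (f : MvPowerSeries ℕ R) (ℓ : ℕ) {U S : Finset ℕ} (h : U ⊆ S) :
    restrictVars R U (truncOn f ℓ S) = truncOn f ℓ U := by
  ext d
  rw [coeff_restrictVars, coeff_truncOn, coeff_truncOn]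
  by_cases hd : d.support ⊆ U
  · simp [hd, hd.trans h]
  · simp [hd]

theorem restrictVars_esymmOn (k : ℕ) {U S : Finset ℕ} (h : U ⊆ S) :
    restrictVars R U (esymmOn R S k) = esymmOn R U k := by
  simp only [esymmOn, restrictVars, map_sum, map_prod, MvPolynomial.aeval_X]
  have := fun t => prod_ite_X_zero (MvPolynomial.X (R := R)) U t (fun _ => 1) (by simp)
  simp only [pow_one] at this
  simp only [this]
  rw [← sum_filter]
  refine sum_congr ?_ fun _ _ => rfl
  ext t
  simp only [mem_filter, mem_powersetCard]
  exact ⟨fun ht => ⟨ht.2, ht.1.2⟩, fun ht => ⟨⟨ht.1.trans h, ht.2⟩, ht.1⟩⟩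

theorem rename_truncOn {f : MvPowerSeries ℕ R}
    (hf : ∀ (σ : Equiv.Perm ℕ) d, MvPowerSeries.coeff (d.mapDomain σ) f = MvPowerSeries.coeff d f)
    (ℓ : ℕ) (S : Finset ℕ) (σ : Equiv.Perm ℕ) :
    MvPolynomial.rename σ (truncOn f ℓ S) = truncOn f ℓ (S.map σ.toEmbedding) := by
  ext d
  obtain ⟨d, rfl⟩ : ∃ d', Finsupp.mapDomain σ d' = d :=
    ⟨d.mapDomain σ.symm, by rw [← Finsupp.mapDomain_comp]; simp⟩
  have hsupp : (d.mapDomain σ).support = d.support.map σ.toEmbedding := by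
    rw [Finsupp.mapDomain_support_of_injective σ.injective, map_eq_image]; rfl
  rw [MvPolynomial.coeff_rename_mapDomain _ σ.injective, coeff_truncOn, coeff_truncOn, hf]
  simp only [hsupp, map_subset_map, Finsupp.degree_mapDomain]

theorem rename_esymmOn (k : ℕ) (S : Finset ℕ) (σ : Equiv.Perm ℕ) :
    MvPolynomial.rename σ (esymmOn R S k) = esymmOn R (S.map σ.toEmbedding) k := by
  simp only [esymmOn, map_sum, map_prod, MvPolynomial.rename_X, powersetCard_map, sum_map]
  refine sum_congr rfl fun t _ => ?_
  simp [mapEmbedding_apply]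

theorem rename_esymm (n k : ℕ) :
    MvPolynomial.rename Fin.val (MvPolynomial.esymm (Fin n) R k) = esymmOn R (range n) k := by
  have : range n = univ.map (Fin.valEmbedding (n := n)) := by ext; simp
  simp only [esymmOn, MvPolynomial.esymm, map_sum, map_prod, MvPolynomial.rename_X, this,
    powersetCard_map, sum_map]
  refine sum_congr rfl fun t _ => ?_
  simp [mapEmbedding_apply]

theorem isHomogeneous_esymmOn (S : Finset ℕ) (k : ℕ) : (esymmOn R S k).IsHomogeneous k := by
  refine MvPolynomial.IsHomogeneous.sum _ _ _ fun t ht => ?_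
  have := MvPolynomial.IsHomogeneous.prod t (fun i => (MvPolynomial.X i : MvPolynomial ℕ R))
    (fun _ => 1) fun i _ => MvPolynomial.isHomogeneous_X R i
  simpa [(mem_powersetCard.1 ht).2] using this

/-- The weight for which the `i`-th variable has weight `i + 1`. -/
abbrev esymmWeight (n : ℕ) (i : Fin n) : ℕ := i + 1

theorem isHomogeneous_aeval_monomial_esymmOn (S : Finset ℕ) {n : ℕ} (d : Fin n →₀ ℕ) (r : R) :
    (MvPolynomial.aeval (fun i : Fin n => esymmOn R S (i + 1))
      (MvPolynomial.monomial d r)).IsHomogeneous (Finsupp.weight (esymmWeight n) d) := by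
  rw [MvPolynomial.aeval_monomial, MvPolynomial.algebraMap_eq]
  refine MvPolynomial.IsHomogeneous.C_mul ?_ r
  rw [Finsupp.weight_apply, Finsupp.sum, Finsupp.prod]
  refine MvPolynomial.IsHomogeneous.prod _ _ _ fun i _ => ?_
  rw [smul_eq_mul, mul_comm]
  exact (isHomogeneous_esymmOn S _).pow _

/-- Substituting elementary symmetric polynomials turns weight into degree, so isobaric parts
correspond to homogeneous parts. -/
theorem homogeneousComponent_aeval_esymmOn (S : Finset ℕ) {n : ℕ} (P : MvPolynomial (Fin n) R)
    (m : ℕ) : MvPolynomial.homogeneousComponent m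
        (MvPolynomial.aeval (fun i : Fin n => esymmOn R S (i + 1)) P) =
      MvPolynomial.aeval (fun i : Fin n => esymmOn R S (i + 1))
        (MvPolynomial.weightedHomogeneousComponent (esymmWeight n) m P) := by
  induction P using MvPolynomial.induction_on' with
  | add p r hp hr => simp only [map_add, hp, hr]
  | monomial d r =>
    rw [MvPolynomial.homogeneousComponent_of_mem
        ((MvPolynomial.mem_homogeneousSubmodule _ _).2 (isHomogeneous_aeval_monomial_esymmOn S d r)),
      MvPolynomial.weightedHomogeneousComponent_of_mem
        ((MvPolynomial.mem_weightedHomogeneousSubmodule _ _ _ _).2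
          (MvPolynomial.isWeightedHomogeneous_monomial (esymmWeight n) d r rfl))]
    split_ifs <;> simp

/-- Induction on the number of elements outside `range n`: each is swapped with a free place inside,
which exists because `#U ≤ n`. -/
theorem exists_perm_map_subset_range {n : ℕ} (U : Finset ℕ) (h : #U ≤ n) :
    ∃ σ : Equiv.Perm ℕ, U.map σ.toEmbedding ⊆ range n := by
  induction hm : #(U \ range n) generalizing U with
  | zero =>
    refine ⟨1, ?_⟩
    rw [card_eq_zero, sdiff_eq_empty_iff_subset] at hm
    intro i hi
    obtain ⟨j, hj, rfl⟩ := mem_map.1 hi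
    exact hm hj
  | succ m ih =>
    obtain ⟨a, ha⟩ : (U \ range n).Nonempty := card_pos.1 (by omega)
    obtain ⟨b, hb⟩ : (range n \ U).Nonempty := by
      rw [← card_pos, ← card_sdiff_add_card_inter U (range n)] at *
      have h1 := card_sdiff_add_card_inter (range n) U
      rw [inter_comm, card_range] at h1
      omega
    rw [mem_sdiff] at ha hb
    have hV : (U.map (Equiv.swap a b).toEmbedding) \ range n = (U \ range n).erase a := by
      ext i
      simp only [mem_sdiff, mem_map_equiv, mem_erase, Equiv.symm_swap]
      by_cases hia : i = a
      · subst hia; simp [hb.2]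
      by_cases hib : i = b
      · subst hib; simp [hb.1, hb.2]
      simp [Equiv.swap_apply_of_ne_of_ne hia hib, hia]
    obtain ⟨σ, hσ⟩ := ih (U.map (Equiv.swap a b).toEmbedding) (by simpa using h) (by
      rw [hV, card_erase_of_mem (mem_sdiff.2 ha), hm]; rfl)
    refine ⟨σ * Equiv.swap a b, ?_⟩
    rw [Finset.map_map] at hσ
    exact hσ

theorem exists_truncOn_range_eq_aeval {f : MvPowerSeries ℕ R}
    (hf : ∀ (σ : Equiv.Perm ℕ) d, MvPowerSeries.coeff (d.mapDomain σ) f = MvPowerSeries.coeff d f)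
    (ℓ : ℕ) : ∃ P : MvPolynomial (Fin ℓ) R, P.IsWeightedHomogeneous (esymmWeight ℓ) ℓ ∧
      truncOn f ℓ (range ℓ) = MvPolynomial.aeval (fun i : Fin ℓ => esymmOn R (range ℓ) (i + 1)) P := by
  obtain ⟨g, hg⟩ := MvPolynomial.exists_rename_eq_of_vars_subset_range (truncOn f ℓ (range ℓ))
    (Fin.val : Fin ℓ → ℕ) Fin.val_injective (by
      intro i hi
      obtain ⟨d, hd, hi⟩ := (MvPolynomial.mem_vars_iff_mem_support i).1 (mem_coe.1 hi)
      rw [MvPolynomial.mem_support_iff, coeff_truncOn] at hd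
      have hd' : d.support ⊆ range ℓ := by
        by_contra hc
        exact hd (if_neg fun h => hc h.2)
      exact ⟨⟨i, mem_range.1 (hd' hi)⟩, rfl⟩)
  have hsymm : g.IsSymmetric := by
    intro σ
    apply MvPolynomial.rename_injective _ Fin.val_injective
    -- Extending `σ` by the identity beyond `ℓ` makes the symmetry of `f` under permutations of `ℕ`
    -- applicable.
    let τ : Equiv.Perm ℕ := σ.viaEmbedding Fin.valEmbedding
    have hτ : ∀ i : Fin ℓ, τ i = σ i := fun i => Equiv.Perm.viaEmbedding_apply σ Fin.valEmbedding i
    have hcomp : (Fin.val ∘ σ : Fin ℓ → ℕ) = τ ∘ Fin.val := funext fun i => (hτ i).symm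
    rw [MvPolynomial.rename_rename, hcomp, ← MvPolynomial.rename_rename, hg, rename_truncOn hf]
    congr 1
    refine eq_of_subset_of_card_le (fun i hi => ?_) (by simp)
    obtain ⟨j, hj, rfl⟩ := mem_map.1 hi
    have := hτ ⟨j, mem_range.1 hj⟩
    simp only [Equiv.coe_toEmbedding, mem_range] at this ⊢
    rw [this]
    exact Fin.is_lt _
  obtain ⟨P, hP⟩ := MvPolynomial.esymmAlgHom_surjective (σ := Fin ℓ) R (n := ℓ) (by simp) ⟨g, hsymm⟩
  have hP' : MvPolynomial.aeval (fun i : Fin ℓ => MvPolynomial.esymm (Fin ℓ) R (i + 1)) P = g := by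
    rw [← MvPolynomial.esymmAlgHom_apply, hP]
  -- Only the part of weight `ℓ` is kept; the identity survives because the truncation is
  -- homogeneous of degree `ℓ`.
  refine ⟨MvPolynomial.weightedHomogeneousComponent (esymmWeight ℓ) ℓ P,
    MvPolynomial.weightedHomogeneousComponent_isWeightedHomogeneous ℓ P, ?_⟩
  have h := congrArg (MvPolynomial.rename Fin.val) hP'
  rw [hg, ← AlgHom.comp_apply, MvPolynomial.comp_aeval] at h
  simp only [rename_esymm] at h
  rw [← homogeneousComponent_aeval_esymmOn, h, MvPolynomial.homogeneousComponent_of_mem (n := ℓ),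
    if_pos rfl]
  rw [MvPolynomial.mem_homogeneousSubmodule]
  refine MvPolynomial.IsHomogeneous.sum _ _ _ fun d hd => MvPolynomial.isHomogeneous_monomial _ ?_
  exact (mem_finsuppAntidiag'.1 hd).1

/-- A homogeneous symmetric function of degree `ℓ` is a polynomial in the elementary symmetric
functions of degrees `1, …, ℓ`, uniformly in the set of variables. -/
theorem exists_truncOn_eq_aeval {f : MvPowerSeries ℕ R}
    (hf : ∀ (σ : Equiv.Perm ℕ) d, MvPowerSeries.coeff (d.mapDomain σ) f = MvPowerSeries.coeff d f)
    (ℓ : ℕ) : ∃ P : MvPolynomial (Fin ℓ) R, P.IsWeightedHomogeneous (esymmWeight ℓ) ℓ ∧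
      ∀ S, truncOn f ℓ S = MvPolynomial.aeval (fun i : Fin ℓ => esymmOn R S (i + 1)) P := by
  obtain ⟨P, hPw, hP⟩ := exists_truncOn_range_eq_aeval hf ℓ
  refine ⟨P, hPw, ?_⟩
  have hres : ∀ {U S : Finset ℕ}, U ⊆ S →
      restrictVars R U (MvPolynomial.aeval (fun i : Fin ℓ => esymmOn R S (i + 1)) P) =
        MvPolynomial.aeval (fun i : Fin ℓ => esymmOn R U (i + 1)) P := fun h => by
    rw [← AlgHom.comp_apply, MvPolynomial.comp_aeval]
    simp only [restrictVars_esymmOn _ h]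
  have hsmall : ∀ U : Finset ℕ, #U ≤ ℓ →
      truncOn f ℓ U = MvPolynomial.aeval (fun i : Fin ℓ => esymmOn R U (i + 1)) P := by
    intro U hU
    obtain ⟨σ, hσ⟩ := exists_perm_map_subset_range U hU
    have h := congrArg (restrictVars R (U.map σ.toEmbedding)) hP
    rw [restrictVars_truncOn f ℓ hσ, hres hσ] at h
    apply MvPolynomial.rename_injective σ σ.injective
    rw [rename_truncOn hf, h, ← AlgHom.comp_apply, MvPolynomial.comp_aeval]
    simp only [rename_esymmOn]
  intro S
  ext d
  have hhom : (MvPolynomial.aeval (fun i : Fin ℓ => esymmOn R S (i + 1)) P).IsHomogeneous ℓ := by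
    rw [← MvPolynomial.weightedHomogeneousComponent_eq_self hPw,
      ← homogeneousComponent_aeval_esymmOn]
    exact MvPolynomial.homogeneousComponent_isHomogeneous _ _
  by_cases hd : d.degree = ℓ
  swap
  · rw [coeff_truncOn, if_neg (fun h => hd h.1), hhom.coeff_eq_zero hd]
  -- A monomial of degree `ℓ` involves at most `ℓ` variables, so its coefficient is already
  -- determined on its own support, where the identity is known.
  have hdS := congrArg (MvPolynomial.coeff d) (hsmall d.support (by
    rw [← hd, Finsupp.degree_apply, card_eq_sum_ones]
    exact sum_le_sum fun i hi => Nat.one_le_iff_ne_zero.2 (Finsupp.mem_support_iff.1 hi)))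
  by_cases h : d.support ⊆ S
  · rw [← restrictVars_truncOn f ℓ h, ← hres h, coeff_restrictVars, coeff_restrictVars] at hdS
    simpa using hdS
  · have h2 := congrArg (MvPolynomial.coeff d) (hres (subset_refl S))
    rw [coeff_restrictVars, if_neg h] at h2
    rw [coeff_truncOn, if_neg (fun h' => h h'.2), ← h2]

theorem IsSymmetricFunction.coeff_mapDomain {f : MvPowerSeries ℕ R} (hf : IsSymmetricFunction f)
    (σ : Equiv.Perm ℕ) (d : ℕ →₀ ℕ) :
    MvPowerSeries.coeff (d.mapDomain σ) f = MvPowerSeries.coeff d f := by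
  have h := MvPowerSeries.coeff_embDomain_rename σ.toEmbedding f d
  rw [Finsupp.embDomain_eq_mapDomain] at h
  rw [← h]
  conv_lhs => rw [← hf σ]
  rfl

end Symmetric

/-! ### Evaluating symmetric functions through limits of elementary ones. -/

section Values
open Finset Filter Topology
variable {R S : Type*} [CommRing R] [CommRing S]

theorem eval₂_esymmOn (φ : R →+* S) (x : ℕ → S) (T : Finset ℕ) (k : ℕ) :
    (esymmOn R T k).eval₂ φ x = ∑ t ∈ powersetCard k T, ∏ i ∈ t, x i := by
  simp [esymmOn, MvPolynomial.eval₂_sum, MvPolynomial.eval₂_prod]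

theorem eval₂_truncOn (φ : R →+* S) (x : ℕ → S) (f : MvPowerSeries ℕ R) (ℓ : ℕ) (T : Finset ℕ) :
    (truncOn f ℓ T).eval₂ φ x = ∑ d ∈ finsuppAntidiag T ℓ,
      φ (MvPowerSeries.coeff d f) * d.prod fun i k => x i ^ k := by
  simp [truncOn, MvPolynomial.eval₂_sum, MvPolynomial.eval₂_monomial]

/-- Used with `a` equal to `π̄^(q-1)`: isobaricity collects all powers of the period into a single
factor. -/
theorem eval₂_mul_pow_of_isWeightedHomogeneous {n m : ℕ}
    {P : MvPolynomial (Fin n) R} (hP : P.IsWeightedHomogeneous (esymmWeight n) m) (φ : R →+* S)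
    (a : S) (y : ℕ → S) :
    P.eval₂ φ (fun i : Fin n => a ^ (i + 1 : ℕ) * y (i + 1)) =
      a ^ m * P.eval₂ φ (fun i : Fin n => y (i + 1)) := by
  rw [MvPolynomial.eval₂_eq, MvPolynomial.eval₂_eq, mul_sum]
  refine sum_congr rfl fun d hd => ?_
  have hw := hP (MvPolynomial.mem_support_iff.1 hd)
  rw [Finsupp.weight_apply, Finsupp.sum] at hw
  simp only [mul_pow, prod_mul_distrib, ← pow_mul]
  rw [prod_pow_eq_pow_sum, ← hw]
  simp only [smul_eq_mul, mul_comm (d _)]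
  ring

variable [TopologicalSpace S]

theorem tendsto_sum_finsuppAntidiag {g : (ℕ →₀ ℕ) → S} {s : S} (hg : HasSum g s) {ℓ : ℕ}
    (hℓ : ∀ d, d.degree ≠ ℓ → g d = 0) {T : ℕ → Finset ℕ} (hT : Tendsto T atTop atTop) :
    Tendsto (fun n => ∑ d ∈ finsuppAntidiag (T n) ℓ, g d) atTop (𝓝 s) := by
  classical
  intro V hV
  obtain ⟨D, hD⟩ := mem_atTop_sets.1 (hg hV)
  rw [Filter.mem_map]
  filter_upwards [hT.eventually_ge_atTop (D.biUnion Finsupp.support)] with n hn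
  -- Adjoining `D` is harmless: once `T n` contains every support occurring in `D`, the new
  -- exponents have degree other than `ℓ` and contribute zero.
  have hsum : ∑ d ∈ finsuppAntidiag (T n) ℓ, g d = ∑ d ∈ D ∪ finsuppAntidiag (T n) ℓ, g d := by
    refine sum_subset subset_union_right fun d hd hd' => hℓ d fun h => hd' ?_
    have hdD : d ∈ D := (mem_union.1 hd).resolve_right hd'
    exact mem_finsuppAntidiag'.2 ⟨h, (subset_biUnion_of_mem Finsupp.support hdD).trans hn⟩
  rw [Set.mem_preimage, hsum]
  exact hD _ subset_union_left

variable [IsTopologicalRing S]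

theorem tendsto_eval₂ {n : ℕ} (φ : R →+* S) (P : MvPolynomial (Fin n) R) {y : ℕ → Fin n → S}
    {E : Fin n → S} (h : ∀ i, Tendsto (fun m => y m i) atTop (𝓝 (E i))) :
    Tendsto (fun m => P.eval₂ φ (y m)) atTop (𝓝 (P.eval₂ φ E)) := by
  simp only [MvPolynomial.eval₂_eq]
  exact tendsto_finsetSum _ fun d _ => tendsto_const_nhds.mul
    (tendsto_finsetProd _ fun i _ => (h i).pow _)

theorem hasValueAt_of_tendsto_esymm (φ : R →+* S) {f : MvPowerSeries ℕ R} {ℓ : ℕ}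
    [T2Space S] (hhom : f.IsHomogeneous ℓ) {x : ℕ → S}
    (hsum : Summable fun d : ℕ →₀ ℕ => φ (MvPowerSeries.coeff d f) * d.prod fun i k => x i ^ k)
    {T : ℕ → Finset ℕ} (hT : Tendsto T atTop atTop) {E : ℕ → S}
    (hE : ∀ k, Tendsto (fun n => ∑ t ∈ powersetCard k (T n), ∏ i ∈ t, x i) atTop (𝓝 (E k)))
    {P : MvPolynomial (Fin ℓ) R}
    (hP : ∀ U, truncOn f ℓ U = MvPolynomial.aeval (fun i : Fin ℓ => esymmOn R U (i + 1)) P) :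
    HasValueAt φ f x (P.eval₂ φ fun i : Fin ℓ => E (i + 1)) := by
  obtain ⟨s, hs⟩ := hsum
  have h1 := tendsto_sum_finsuppAntidiag hs (ℓ := ℓ)
    (fun d hd => by rw [hhom.coeff_eq_zero hd, map_zero, zero_mul]) hT
  have h2 := tendsto_eval₂ φ P (E := fun i : Fin ℓ => E (i + 1)) fun i => hE (i + 1)
  have h3 : ∀ n, (∑ d ∈ finsuppAntidiag (T n) ℓ,
      φ (MvPowerSeries.coeff d f) * d.prod fun i k => x i ^ k) =
      P.eval₂ φ fun i : Fin ℓ => ∑ t ∈ powersetCard (i + 1) (T n), ∏ j ∈ t, x j := by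
    intro n
    rw [← eval₂_truncOn, hP]
    simp only [← eval₂_esymmOn φ]
    rw [MvPolynomial.aeval_def, ← MvPolynomial.coe_eval₂Hom, MvPolynomial.hom_eval₂]
    congr 1
    ext r
    simp [MvPolynomial.algebraMap_eq]
  simp only [h3] at h1
  rw [tendsto_nhds_unique h1 h2] at hs
  exact hs

end Values

/-! ### Independence of the enumeration. -/

section Reindex

variable {R S : Type*} [CommRing R] [CommRing S] [TopologicalSpace S]

theorem HasValueAt.comp_perm {φ : R →+* S} {f : MvPowerSeries ℕ R} {x : ℕ → S} {s : S}
    (hf : IsSymmetricFunction f) (h : HasValueAt φ f x s) (σ : Equiv.Perm ℕ) :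
    HasValueAt φ f (x ∘ σ) s := by
  unfold HasValueAt at *
  rw [← (Finsupp.domCongr (M := ℕ) σ).toEquiv.hasSum_iff] at h
  convert h using 1
  funext d
  have he : (Finsupp.domCongr (M := ℕ) σ).toEquiv d = d.mapDomain σ :=
    Finsupp.equivMapDomain_eq_mapDomain σ d
  rw [Function.comp_apply, he, hf.coeff_mapDomain,
    Finsupp.prod_mapDomain_index_inj σ.injective]
  rfl

end Reindex

/-! ### Limits of the coefficients and of the elementary symmetric functions. -/

section Limits

open Finset Filter Topology

variable {F : Type*} [Field F] [Fintype F] {K : Type*} [Field K] [Algebra F K] (ι : F[X] →ₐ[F] K)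
  [TopologicalSpace K] [IsTopologicalRing K]

local notation "q" => Fintype.card F

/-- Pass to the limit in `carlitzCoeff_succ`: the error factor tends to `1`, and the rational parts
satisfy `r_(i+1) = r_i^q / (T^(q^(i+1)) - T)`. The exponent of `p` is `(q^i - 1)/(q - 1)`, encoded
by the equation for `k` to avoid division. -/
theorem exists_tendsto_carlitzCoeff (hι : Function.Injective ι) (j : RatFunc F →+* K)
    (hj : ∀ A, j (algebraMap F[X] (RatFunc F) A) = ι A) {p : K}
    (hp : Tendsto (periodApprox ι) atTop (𝓝 p))
    (hT : Tendsto (fun d => (ι X ^ q ^ (d + 1))⁻¹) atTop (𝓝 0)) (i : ℕ) :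
    ∃ r : RatFunc F, ∀ k, k * (q - 1) + 1 = q ^ i →
      Tendsto (fun d => carlitzCoeff ι d i) atTop (𝓝 (p ^ k * j r)) := by
  have hq : 1 < q := Fintype.one_lt_card
  induction i with
  | zero =>
    refine ⟨1, fun k hk => ?_⟩
    obtain rfl : k = 0 := by
      simpa [(show q - 1 ≠ 0 by omega)] using hk
    simp [carlitzCoeff_zero ι hι, tendsto_const_nhds]
  | succ i ih =>
    obtain ⟨r, hr⟩ := ih
    obtain ⟨m, hm⟩ : ∃ m, m * (q - 1) + 1 = q ^ i := by
      obtain ⟨m, hm⟩ := Nat.sub_one_dvd_pow_sub_one q i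
      have : 0 < q ^ i := by positivity
      exact ⟨m, by rw [mul_comm, ← hm]; omega⟩
    have hr := hr m hm
    set W := ι X ^ q ^ (i + 1) with hW
    have hne : W - ι X ≠ 0 := by
      rw [hW, ← map_pow, ← map_sub, map_ne_zero_iff _ hι]
      exact FiniteField.X_pow_card_pow_sub_X_ne_zero F (Nat.succ_ne_zero i) hq
    refine ⟨r ^ q / algebraMap F[X] (RatFunc F) (X ^ q ^ (i + 1) - X), fun k hk => ?_⟩
    -- Taking the `q`-th power multiplies the exponent of `p` by `q`, and the factor `periodApprox`
    -- adds one more.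
    have hkm : k = q * m + 1 := by
      obtain ⟨c, hc⟩ : ∃ c, q = c + 2 := ⟨q - 2, by omega⟩
      rw [pow_succ, ← hm, hc] at hk
      rw [hc]
      simp only [show c + 2 - 1 = c + 1 by omega] at hk
      have : k * (c + 1) = ((c + 2) * m + 1) * (c + 1) := by linarith
      exact Nat.eq_of_mul_eq_mul_right (by omega) this
    have hval : p ^ k * j (r ^ q / algebraMap F[X] (RatFunc F) (X ^ q ^ (i + 1) - X)) =
        p * (p ^ m * j r) ^ q * (1 - W * 0) / (W - ι X) := by
      rw [map_div₀, map_pow, hj, map_sub, map_pow, hkm]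
      ring
    rw [hval]
    have hfun : (fun d => carlitzCoeff ι d (i + 1)) = fun d => periodApprox ι d *
        carlitzCoeff ι d i ^ q * (1 - W * (ι X ^ q ^ (d + 1))⁻¹) / (W - ι X) := by
      funext d
      rw [eq_div_iff hne, mul_comm, carlitzCoeff_succ ι hι, div_eq_mul_inv]
    rw [hfun]
    simp only [div_eq_mul_inv]
    exact ((hp.mul (hr.pow q)).mul (tendsto_const_nhds.sub (tendsto_const_nhds.mul hT))).mul
      tendsto_const_nhds

theorem exists_tendsto_esymm (hι : Function.Injective ι) (j : RatFunc F →+* K)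
    (hj : ∀ A, j (algebraMap F[X] (RatFunc F) A) = ι A) {p : K}
    (hp : Tendsto (periodApprox ι) atTop (𝓝 p))
    (hT : Tendsto (fun d => (ι X ^ q ^ (d + 1))⁻¹) atTop (𝓝 0)) (k : ℕ) :
    ∃ r : RatFunc F, Tendsto (fun d => ∑ t ∈ powersetCard k (monicsLT F d),
      ∏ A ∈ t, 1 / ι A ^ (q - 1)) atTop (𝓝 (p ^ k * j r)) := by
  by_cases h : ∃ i, k * (q - 1) + 1 = q ^ i
  · obtain ⟨i, hi⟩ := h
    obtain ⟨r, hr⟩ := exists_tendsto_carlitzCoeff ι hι j hj hp hT i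
    refine ⟨(-1) ^ k * r, ?_⟩
    simp only [esymm_eq_carlitzCoeff ι hι hi]
    have := (hr k hi).const_mul ((-1) ^ k)
    convert this using 2
    simp
    ring
  · push Not at h
    refine ⟨0, ?_⟩
    simp only [esymm_eq_zero ι hι h, map_zero, mul_zero, tendsto_const_nhds]

end Limits

/-! ### Monic polynomials of bounded degree inside an enumeration. -/

section Enumeration
open Finset Filter Topology

variable {F : Type*} [Field F] [Fintype F]

theorem finite_natDegree_lt (N : ℕ) : {A : F[X] | A.natDegree < N}.Finite := by
  refine (polysLT F N).finite_toSet.subset fun A hA => mem_polysLT.2 fun n hn => ?_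
  exact coeff_eq_zero_of_natDegree_lt (lt_of_lt_of_le hA hn)

/-- The positions of the monic polynomials of degree less than `d` in an enumeration. -/
def monicIndices (e : ℕ ≃ {A : F[X] // A.Monic}) (d : ℕ) : Finset ℕ :=
  open Classical in ((polysLT F d).subtype Monic).map e.symm.toEmbedding

open Classical in
theorem tendsto_monicIndices (e : ℕ ≃ {A : F[X] // A.Monic}) :
    Tendsto (monicIndices e) atTop atTop := by
  refine tendsto_atTop_finset_of_monotone (fun a b hab => ?_) fun i => ?_
  · refine map_subset_map.2 fun A hA => ?_
    rw [mem_subtype, mem_polysLT] at *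
    exact fun n hn => hA n (hab.trans hn)
  · refine ⟨(e i).1.natDegree + 1, ?_⟩
    rw [monicIndices, mem_map_equiv, Equiv.symm_symm, mem_subtype, mem_polysLT]
    exact fun n hn => coeff_eq_zero_of_natDegree_lt hn

theorem sum_powersetCard_monicIndices {M : Type*} [CommRing M] (e : ℕ ≃ {A : F[X] // A.Monic})
    (x : F[X] → M) (d k : ℕ) :
    ∑ t ∈ powersetCard k (monicIndices e d), ∏ i ∈ t, x (e i).1 =
      ∑ t ∈ powersetCard k (monicsLT F d), ∏ A ∈ t, x A := by
  have h : monicsLT F d = (monicIndices e d).map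
      (e.toEmbedding.trans (Function.Embedding.subtype Monic)) := by
    ext A
    simp only [mem_monicsLT, monicIndices, Finset.mem_map, mem_subtype]
    refine ⟨fun h => ⟨e.symm ⟨A, h.2⟩, ⟨⟨A, h.2⟩, h.1, rfl⟩, by simp⟩, ?_⟩
    rintro ⟨_, ⟨B, hB, rfl⟩, rfl⟩
    simpa using ⟨hB, B.2⟩
  rw [h, powersetCard_map, sum_map]
  refine sum_congr rfl fun t _ => ?_
  simp [mapEmbedding_apply]

end Enumeration

/-! ### Valuation estimates, summability and the period in the completion. -/

section Completion
open Finset Filter Topology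

variable (F : Type*) [Field F] [DecidableEq (RatFunc F)]

instance completeSpace_KHat : CompleteSpace (KHat F) := inferInstanceAs (CompleteSpace
    (@UniformSpace.Completion (RatFunc F) (RatFunc.inftyValued F).toUniformSpace))

instance nonarchimedeanAddGroup_KHat : NonarchimedeanAddGroup (KHat F) := by
  have h : @NonarchimedeanRing (KHat F) _
      (Valued.v (R := KHat F)).subgroups_basis.topology :=
    (Valued.v (R := KHat F)).subgroups_basis.nonarchimedean
  have e : (inferInstance : TopologicalSpace (KHat F)) =
      (Valued.v (R := KHat F)).subgroups_basis.topology :=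
    congrArg (·.toTopologicalSpace) (Valued.toUniformSpace_eq (KHat F) _)
  rw [← e] at h
  exact NonarchimedeanRing.to_nonarchimedeanAddGroup _

variable {F}

theorem tendsto_zero_of_valuation_lt {α : Type*} {l : Filter α} {g : α → KHat F}
    (h : ∀ k : ℤ, ∀ᶠ a in l, Valued.v (g a) < WithZero.exp k) : Tendsto g l (𝓝 0) := by
  rw [(Valued.hasBasis_nhds_zero (KHat F) _).tendsto_right_iff]
  intro γ _
  have hγ : MonoidWithZeroHom.ValueGroup₀.embedding γ.1 ≠ 0 := by simp
  filter_upwards [h (WithZero.log (MonoidWithZeroHom.ValueGroup₀.embedding γ.1))] with a ha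
  change (Valued.v (R := KHat F)).restrict _ < _
  rw [Valuation.restrict_lt_iff_lt_embedding]
  rwa [WithZero.exp_log hγ] at ha

theorem exists_valuation_le_exp {s : Set (KHat F)} (hs : s.Finite) :
    ∃ M : ℤ, ∀ a ∈ s, Valued.v a ≤ WithZero.exp M := by
  induction s, hs using Set.Finite.induction_on with
  | empty => exact ⟨0, by simp⟩
  | @insert a s _ _ ih =>
    obtain ⟨M, hM⟩ := ih
    refine ⟨max M (WithZero.log (Valued.v a)), ?_⟩
    rintro b (rfl | hb)
    · by_cases h0 : Valued.v b = 0
      · rw [h0]; exact zero_le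
      · conv_lhs => rw [← WithZero.exp_log h0]
        exact WithZero.exp_le_exp.2 (le_max_right _ _)
    · exact (hM b hb).trans (WithZero.exp_le_exp.2 (le_max_left _ _))

/-- A permutation moves any monomial of degree `ℓ` into the first `ℓ` variables, and only finitely
many monomials of degree `ℓ` live there. This bounds the coefficients of an infinite `f` after
mapping to the completion. -/
theorem finite_range_coeff {R : Type*} [CommRing R] {f : MvPowerSeries ℕ R} {ℓ : ℕ}
    (hf : IsSymmetricFunction f) (hhom : f.IsHomogeneous ℓ) :
    (Set.range fun d : ℕ →₀ ℕ => MvPowerSeries.coeff d f).Finite := by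
  classical
  refine ((insert 0 ((finsuppAntidiag (range ℓ) ℓ).image
    fun d => MvPowerSeries.coeff d f)).finite_toSet).subset ?_
  rintro _ ⟨d, rfl⟩
  simp only [coe_insert, coe_image, Set.mem_insert_iff, Set.mem_image, mem_coe]
  by_cases hd : d.degree = ℓ
  · right
    obtain ⟨σ, hσ⟩ := exists_perm_map_subset_range (n := ℓ) d.support (by
      rw [← hd, Finsupp.degree_apply, card_eq_sum_ones]
      exact sum_le_sum fun i hi => Nat.one_le_iff_ne_zero.2 (Finsupp.mem_support_iff.1 hi))
    refine ⟨d.mapDomain σ, mem_finsuppAntidiag'.2 ⟨?_, ?_⟩, hf.coeff_mapDomain σ d⟩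
    · exact (Finsupp.degree_mapDomain _ _).trans hd
    · rw [Finsupp.mapDomain_support_of_injective σ.injective]
      rwa [map_eq_image] at hσ
  · left
    exact hhom.coeff_eq_zero hd

theorem summable_value {R : Type*} [CommRing R] (φ : R →+* KHat F) {f : MvPowerSeries ℕ R} {ℓ : ℕ}
    (hf : IsSymmetricFunction f) (hhom : f.IsHomogeneous ℓ) {x : ℕ → KHat F}
    (hx1 : ∀ i, Valued.v (x i) ≤ 1)
    (hx : ∀ k : ℤ, {i | ¬ Valued.v (x i) < WithZero.exp k}.Finite) :
    Summable fun d : ℕ →₀ ℕ => φ (MvPowerSeries.coeff d f) * d.prod fun i k => x i ^ k := by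
  apply NonarchimedeanAddGroup.summable_of_tendsto_cofinite_zero
  apply tendsto_zero_of_valuation_lt
  intro k
  obtain ⟨M, hM⟩ := exists_valuation_le_exp ((finite_range_coeff hf hhom).image φ)
  rw [eventually_cofinite]
  -- One variable of valuation below `exp (k - M)` makes the term small, since the coefficient is at
  -- most `exp M` and the other factors at most `1`. Large terms thus involve only finitely many
  -- variables.
  refine (finsuppAntidiag (hx (k - M)).toFinset ℓ).finite_toSet.subset fun d hd => ?_
  rw [mem_coe, mem_finsuppAntidiag']
  refine ⟨?_, fun i hi => ?_⟩
  · by_contra h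
    refine hd ?_
    rw [hhom.coeff_eq_zero h]
    simp
  · rw [Set.Finite.mem_toFinset]
    intro hlt
    refine hd ?_
    have hi0 := Finsupp.mem_support_iff.1 hi
    have h1 : Valued.v (d.prod fun i k => x i ^ k) < WithZero.exp (k - M) := by
      refine lt_of_le_of_lt ?_ hlt
      rw [Finsupp.prod, map_prod, ← mul_prod_erase _ _ hi, map_pow]
      refine (mul_le_of_le_one_right' (prod_le_one' fun j _ => ?_)).trans ?_
      · rw [map_pow]
        exact pow_le_one' (hx1 j) _
      · exact pow_le_of_le_one zero_le (hx1 i) hi0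
    calc Valued.v (φ (MvPowerSeries.coeff d f) * d.prod fun i k => x i ^ k)
        ≤ WithZero.exp M * Valued.v (d.prod fun i k => x i ^ k) := by
          rw [map_mul]
          exact mul_le_mul_left (hM _ ⟨_, ⟨d, rfl⟩, rfl⟩) _
      _ < WithZero.exp M * WithZero.exp (k - M) := by
          exact mul_lt_mul_of_pos_left h1 WithZero.exp_pos
      _ = WithZero.exp k := by rw [← WithZero.exp_add]; congr 1; ring

theorem polyToKHat_injective : Function.Injective (polyToKHat F) :=
  (algebraMap (RatFunc F) (KHat F)).injective.comp (RatFunc.algebraMap_injective F)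

variable [Fintype F]

local notation "q" => Fintype.card F

theorem valuation_one_div_pow {A : F[X]} (hA : A ≠ 0) :
    Valued.v (1 / polyToKHat F A ^ (q - 1)) = WithZero.exp (-((q - 1) * A.natDegree : ℕ) : ℤ) := by
  rw [one_div, map_inv₀, map_pow, v_polyToKHat F hA, ← WithZero.exp_nsmul, ← WithZero.exp_neg]
  simp

theorem finite_not_valuation_lt (e : ℕ ≃ {A : F[X] // A.Monic}) (k : ℤ) :
    {i | ¬ Valued.v (1 / polyToKHat F (e i).1 ^ (q - 1)) < WithZero.exp k}.Finite := by
  have hq : 1 < q := Fintype.one_lt_card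
  refine Set.Finite.of_finite_image (f := fun i => (e i).1) ?_
    (Subtype.val_injective.comp e.injective).injOn
  refine (finite_natDegree_lt (F := F) ((-k).toNat + 1)).subset ?_
  rintro _ ⟨i, hi, rfl⟩
  rw [Set.mem_ofPred_eq, valuation_one_div_pow (e i).2.ne_zero, WithZero.exp_lt_exp] at hi
  change (e i).1.natDegree < _
  have : (e i).1.natDegree ≤ (q - 1) * (e i).1.natDegree := Nat.le_mul_of_pos_left _ (by omega)
  omega

theorem valuation_le_one {A : F[X]} (hA : A ≠ 0) :
    Valued.v (1 / polyToKHat F A ^ (q - 1)) ≤ 1 := by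
  rw [valuation_one_div_pow hA, ← WithZero.exp_zero, WithZero.exp_le_exp]
  omega

theorem tendsto_inv_X_pow :
    Tendsto (fun d => (polyToKHat F X ^ q ^ (d + 1))⁻¹) atTop (𝓝 0) := by
  apply tendsto_zero_of_valuation_lt
  intro k
  filter_upwards [eventually_ge_atTop (-k).toNat] with d hd
  rw [map_inv₀, map_pow, v_polyToKHat F X_ne_zero, ← WithZero.exp_nsmul, ← WithZero.exp_neg,
    WithZero.exp_lt_exp]
  have : d + 1 < q ^ (d + 1) := Nat.lt_pow_self Fintype.one_lt_card
  simp only [natDegree_X, nsmul_eq_mul, Nat.cast_one, mul_one]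
  omega

open Classical in
theorem tendsto_partial_periodProduct :
    Tendsto (fun d => ∏ A ∈ (polysLT F d).erase 0, (1 - (polyToKHat F (X * A))⁻¹)) atTop
      (𝓝 (periodProduct F)) := by
  have h : Tendsto (fun s : Finset {A : F[X] // A ≠ 0} =>
      ∏ A ∈ s, (1 - (polyToKHat F (X * A.1))⁻¹)) atTop (𝓝 (periodProduct F)) := by
    have := (multipliable_periodProduct F).hasProd
    rwa [HasProd, SummationFilter.unconditional_filter] at this
  have hS : Tendsto (fun d => (polysLT F d).subtype (· ≠ 0)) atTop atTop := by
    refine tendsto_atTop_finset_of_monotone (fun a b hab A hA => ?_) fun A => ?_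
    · rw [mem_subtype, mem_polysLT] at *
      exact fun n hn => hA n (hab.trans hn)
    · refine ⟨A.1.natDegree + 1, ?_⟩
      rw [mem_subtype, mem_polysLT]
      exact fun n hn => coeff_eq_zero_of_natDegree_lt hn
  refine (h.comp hS).congr fun d => ?_
  rw [Function.comp_apply, prod_subtype_eq_prod_filter
    (f := fun A : F[X] => 1 - (polyToKHat F (X * A))⁻¹), filter_ne']

variable (F) in
/-- The power `π̄ ^ (q - 1)` of the Carlitz period, as an element of the completion. -/
def periodPow : KHat F := -polyToKHat F X ^ q / periodProduct F ^ (q - 1)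

theorem carlitzPeriod_pow {L : Type*} [Field L] [Algebra (KHat F) L] {lam : L}
    (hlam : lam ^ (q - 1) = -algebraMap (KHat F) L (polyToKHat F X)) :
    carlitzPeriod F L lam ^ (q - 1) = algebraMap (KHat F) L (periodPow F) := by
  rw [carlitzPeriod, div_pow, mul_pow, hlam, periodPow, map_div₀, map_neg, map_pow, map_pow,
    mul_neg, ← pow_succ, Nat.sub_add_cancel Fintype.card_pos]

theorem exists_tendsto_esymm_KHat (k : ℕ) :
    ∃ r : RatFunc F, Tendsto (fun d => ∑ t ∈ powersetCard k (monicsLT F d),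
      ∏ A ∈ t, 1 / polyToKHat F A ^ (q - 1)) atTop
        (𝓝 (periodPow F ^ k * algebraMap (RatFunc F) (KHat F) r)) := by
  -- A local `F`-algebra structure turns `polyToKHat` into the algebra homomorphism `ι` of the
  -- preceding sections.
  let _ : Algebra F (KHat F) := ((polyToKHat F).comp C).toAlgebra
  let ι : F[X] →ₐ[F] KHat F := { polyToKHat F with commutes' := fun _ => rfl }
  refine exists_tendsto_esymm ι polyToKHat_injective (algebraMap (RatFunc F) (KHat F))
    (fun _ => rfl) ?_ tendsto_inv_X_pow k
  exact tendsto_const_nhds.div (tendsto_partial_periodProduct.pow _)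
    (pow_ne_zero _ (periodProduct_ne_zero F))

end Completion
end CarlitzSym

end

theorem corollary2p3 (F : Type*) [Field F] [Fintype F] [DecidableEq (RatFunc F)]
    {R : Type*} [CommRing R] (φ : R →+* RatFunc F)
    (f : MvPowerSeries ℕ R) (ℓ : ℕ)
    (hsymm : CarlitzSym.IsSymmetricFunction f) (hhom : MvPowerSeries.IsHomogeneous f ℓ)
    {L : Type*} [Field L] [Algebra (CarlitzSym.KHat F) L]
    (lam : L)
    (hlam : lam ^ (Fintype.card F - 1) =
      -algebraMap (CarlitzSym.KHat F) L (CarlitzSym.polyToKHat F Polynomial.X)) :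
    ∃ s : CarlitzSym.KHat F,
      (∀ e : ℕ ≃ {A : Polynomial F // A.Monic},
        CarlitzSym.HasValueAt ((algebraMap (RatFunc F) (CarlitzSym.KHat F)).comp φ) f
          (fun i => 1 / CarlitzSym.polyToKHat F (e i).1 ^ (Fintype.card F - 1)) s) ∧
      ∃ c : RatFunc F,
        algebraMap (CarlitzSym.KHat F) L s =
          CarlitzSym.carlitzPeriod F L lam ^ (ℓ * (Fintype.card F - 1)) *
            algebraMap (CarlitzSym.KHat F) L (algebraMap (RatFunc F) (CarlitzSym.KHat F) c) := by
  obtain ⟨e₀⟩ := CarlitzSym.exists_enum F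
  obtain ⟨P, hPw, hP⟩ := CarlitzSym.exists_truncOn_eq_aeval
    (CarlitzSym.IsSymmetricFunction.coeff_mapDomain hsymm) ℓ
  choose r hr using CarlitzSym.exists_tendsto_esymm_KHat (F := F)
  have hval := CarlitzSym.hasValueAt_of_tendsto_esymm
    ((algebraMap (RatFunc F) (CarlitzSym.KHat F)).comp φ) hhom
    (CarlitzSym.summable_value _ hsymm hhom
      (fun i => CarlitzSym.valuation_le_one (e₀ i).2.ne_zero)
      (CarlitzSym.finite_not_valuation_lt e₀))
    (CarlitzSym.tendsto_monicIndices e₀)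
    (fun k => by
      simpa only [CarlitzSym.sum_powersetCard_monicIndices e₀
        (fun A => 1 / CarlitzSym.polyToKHat F A ^ (Fintype.card F - 1))] using hr k) hP
  -- The limits have the form `periodPow ^ k * r k` with `r k` rational, so the value is `periodPow
  -- ^ ℓ` times `P` evaluated at rational functions.
  rw [CarlitzSym.eval₂_mul_pow_of_isWeightedHomogeneous hPw _ _
    (fun k => algebraMap (RatFunc F) (CarlitzSym.KHat F) (r k))] at hval
  refine ⟨CarlitzSym.periodPow F ^ ℓ * algebraMap (RatFunc F) (CarlitzSym.KHat F)
    (P.eval₂ φ fun i : Fin ℓ => r (i + 1)), fun e => ?_,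
    P.eval₂ φ fun i : Fin ℓ => r (i + 1), ?_⟩
  · rw [MvPolynomial.hom_eval₂]
    -- Any enumeration differs from `e₀` by a permutation of `ℕ`.
    convert hval.comp_perm hsymm (e.trans e₀.symm) using 2 with i
    simp
  · rw [map_mul, map_pow, mul_comm ℓ, pow_mul, CarlitzSym.carlitzPeriod_pow hlam]
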